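/- Let $\Delta$ be the simplicial category and let $n\geq 1$. Spaces are compactly generated Hausdorff spaces, and products of spaces carry the compactly generated topology. For $m\geq 1$ and $1\leq j\leq m$ let $i_j:[m]\to[1]$ be the arrow of $\Delta^{op}$ opposite to the monotone map $\{0,1\}\to\{0,\ldots,m\}$, $0\mapsto j-1$, $1\mapsto j$. For a simplicial space, or a lax functor from $\Delta^{op}$ to the 2-category $\mathit{Cat}$ of small categories, denoted by $X$, let $p_m=\langle X(i_1),\ldots,X(i_m)\rangle:X_m\to (X_1)^m$; for $m=0$ this is the unique arrow from $X_0$ to the terminal object. For $X$ defined on $(\Delta^{op})^n$, for $l\in\{0,\ldots,n-1\}$ and $k\geq 0$, let $X_{1\ldots 1\,\_\,k\ldots k}$ be its restriction to $\Delta^{op}$ obtained by fixing the first $l$ arguments to be $[1]$ and the last $n-l-1$ arguments to be $[k]$. A lax functor $W$ consists of categories $W(A)$, functors $W(f)$ and natural transformations $W(g)\circ W(f)\to W(g\circ f)$ and $\mathrm{id}_{W(A)}\to W(\mathrm{id}_A)$ satisfying the usual coherence conditions. A lax functor $W:\Delta^{op}\to\mathit{Cat}$ is Segal's when, for every $m\geq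 0$, the functor $p_m:W_m\to(W_1)^m$ is an isomorphism of categories (that is, it identifies $W_m$ with the $m$-th power of $W_1$). A lax functor $W:(\Delta^{op})^n\to\mathit{Cat}$ is Segal's when $W_{1\ldots 1\,\_\,k\ldots k}$ is Segal's for all $l\in\{0,\ldots,n-1\}$ and $k\geq 0$. A functor $V:\mathcal A\to\mathit{Cat}$ is a rectification of a lax functor $W:\mathcal A\to\mathit{Cat}$ when there are a left lax transformation $E:V\to W$, with structure transformations $W(f)\circ E_A\to E_B\circ V(f)$ for $f:A\to B$, and a right lax transformation $J:W\to V$, with structure transformations $J_B\circ W(f)\to V(f)\circ J_A$, such that $J_A$ is left adjoint to $E_A$ for every object $A$ and $W(f)=E_B\circ V(f)\circ J_A$ for every arrow $f:A\to B$ of $\mathcal A$. A multisimplicial space, i.e. a functor $X$ from $(\Delta^{op})^n$ to spaces, is a partially realized multisimplicial set (PRmss) if, up to natural homeomorphism, it is obtained from a functor $Y$ from $(\Delta^{op})^{n+p}$ to discrete spaces, for some $p\geq 0$, by geometric realization of the last $p$ coordinates, one after another beginning with the last one. A simplicial space $X$ is Segal's when it is a PRmss and $p_m:X_m\to(X_1)^m$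 is a homotopy equivalence for every $m\geq 0$. A multisimplicial space $X:(\Delta^{op})^n\to\mathit{Top}$ is Segal's when it is a PRmss and the simplicial space $X_{1\ldots 1\,\_\,k\ldots k}$ is Segal's for all $l\in\{0,\ldots,n-1\}$ and $k\geq 0$. Let $B:\mathit{Cat}\to\mathit{Top}$ be the classifying space functor, the geometric realization of the nerve. **Corollary 4.4.** If $W:(\Delta^{op})^n\to\mathit{Cat}$ is a Segal lax functor and $V$ is a rectification of $W$, then $B\circ V$ is a Segal multisimplicial space. -/

import Mathlib

open CategoryTheory Opposite

universe v u w

noncomputable section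

namespace SegalMultisimplicial

/-! ### Index categories and their projections -/

/-- The category `(Δᵒᵖ)ⁿ`. -/
abbrev DeltaPow (n : ℕ) : Type := Fin n → SimplexCategoryᵒᵖ

/-- The arrow `i_{j+1} : [m] ⟶ [1]` of `Δᵒᵖ`, for `0 ≤ j < m`, which is opposite to the monotone
map `{0,1} → {0,…,m}` sending `0` to `j` and `1` to `j + 1`. -/
def proj {m : ℕ} (j : Fin m) : op (SimplexCategory.mk m) ⟶ op (SimplexCategory.mk 1) :=
  (SimplexCategory.mkOfSucc j).op

/-- The functor `Δᵒᵖ ⥤ (Δᵒᵖ)ⁿ` sending `a` to `([1], …, [1], a, [k], …, [k])`, where `a` is at the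
place `l` (counted from `0`), so that there are exactly `l` copies of `[1]`. -/
def line {n : ℕ} (l : Fin n) (k : ℕ) : SimplexCategoryᵒᵖ ⥤ DeltaPow n :=
  Functor.pi' fun i : Fin n =>
    if i < l then (Functor.const _).obj (op (SimplexCategory.mk 1))
    else if i = l then 𝟭 _
    else (Functor.const _).obj (op (SimplexCategory.mk k))

/-- The isomorphism of categories `(Δᵒᵖ)ⁿ × Δᵒᵖ ⥤ (Δᵒᵖ)ⁿ⁺¹` appending a last coordinate. -/
def append (n : ℕ) : DeltaPow n × SimplexCategoryᵒᵖ ⥤ DeltaPow (n + 1) :=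
  Functor.pi' fun i : Fin (n + 1) =>
    Fin.lastCases (motive := fun _ => DeltaPow n × SimplexCategoryᵒᵖ ⥤ SimplexCategoryᵒᵖ)
      (CategoryTheory.Prod.snd _ _) (fun j => CategoryTheory.Prod.fst _ _ ⋙ Pi.eval _ j) i

/-! ### Realization of simplicial spaces -/

/-- The disjoint union of all the `X_n × Δⁿ`. The simplex `Δⁿ` is compact Hausdorff, so for compactly
generated `X_n` the product topology is already compactly generated. -/
abbrev PreRealization (X : SimplexCategoryᵒᵖ ⥤ TopCat.{w}) : Type w :=
  Σ n : SimplexCategory, X.obj (op n) × SimplexCategory.toTop₀.obj n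

/-- The relation `(f^* x, t) ∼ (x, f_* t)`, for all arrows `f` of `Δ`. Since the cofaces and the
codegeneracies generate `Δ`, they suffice to generate the same equivalence relation. -/
inductive RealizationRel (X : SimplexCategoryᵒᵖ ⥤ TopCat.{w}) :
    PreRealization X → PreRealization X → Prop
  | glue {m n : SimplexCategory} (f : m ⟶ n) (x : X.obj (op n))
      (t : SimplexCategory.toTop₀.obj m) :
      RealizationRel X ⟨m, X.map f.op x, t⟩ ⟨n, x, SimplexCategory.toTop₀.map f t⟩

/-- The geometric realization of a simplicial space, with the quotient topology. (`Quot` is the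
quotient by the equivalence relation generated by the given relation.) -/
abbrev Realization (X : SimplexCategoryᵒᵖ ⥤ TopCat.{w}) : Type w :=
  Quot (RealizationRel X)

/-- The map of realizations induced by a simplicial map. -/
def Realization.map {X Y : SimplexCategoryᵒᵖ ⥤ TopCat.{w}} (φ : X ⟶ Y) :
    Realization X → Realization Y :=
  Quot.map (fun z => ⟨z.1, φ.app (op z.1) z.2.1, z.2.2⟩) (by
    rintro _ _ ⟨f, x, t⟩
    have h : φ.app _ (X.map f.op x) = Y.map f.op (φ.app _ x) :=
      ConcreteCategory.congr_hom (φ.naturality f.op) x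
    dsimp only
    rw [h]
    exact RealizationRel.glue f _ t)

theorem Realization.continuous_map {X Y : SimplexCategoryᵒᵖ ⥤ TopCat.{w}} (φ : X ⟶ Y) :
    Continuous (Realization.map φ) := by
  refine continuous_quot_lift _ (continuous_quot_mk.comp ?_)
  refine continuous_sigma fun n => ?_
  exact (continuous_sigmaMk (σ := fun n : SimplexCategory =>
    Y.obj (op n) × SimplexCategory.toTop₀.obj n)).comp
      (((φ.app (op n)).hom.continuous.comp continuous_fst).prodMk continuous_snd)

/-- The realization functor from simplicial spaces to spaces. -/
def realization : (SimplexCategoryᵒᵖ ⥤ TopCat.{w}) ⥤ TopCat.{w} where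
  obj X := TopCat.of (Realization X)
  map φ := TopCat.ofHom ⟨Realization.map φ, Realization.continuous_map φ⟩
  map_id X := by
    ext z
    induction z using Quot.ind
    rfl
  map_comp φ ψ := by
    ext z
    induction z using Quot.ind
    rfl

/-! ### Multisimplicial spaces -/

/-- The partial realization `Y ↦ Y^{(p)}`, which realizes the last `p` coordinates, one at a time
and beginning with the last one. -/
def partialRealization (n : ℕ) :
    (p : ℕ) → (DeltaPow (n + p) ⥤ TopCat.{w}) → (DeltaPow n ⥤ TopCat.{w})
  | 0, Y => Y
  | p + 1, Y =>
      partialRealization n p (Functor.curry.obj (append (n + p) ⋙ Y) ⋙ realization)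

/-- A partially realized multisimplicial set (PRmss): a multisimplicial space which is, up to a
natural homeomorphism, `Y^{(p)}` for some `p` and some multisimplicial set `Y`, i.e. some
multisimplicial space `Y` whose values are all discrete. All values of such a multisimplicial space
are CW-complexes, so they belong to the category of compactly generated Hausdorff spaces. -/
def IsPRmss {n : ℕ} (X : DeltaPow n ⥤ TopCat.{w}) : Prop :=
  ∃ (p : ℕ) (Y : DeltaPow (n + p) ⥤ TopCat.{w}),
    (∀ a, DiscreteTopology (Y.obj a)) ∧ Nonempty (X ≅ partialRealization n p Y)

/-- The `m`-th power of a space in the category of compactly generated spaces: the set `X^m` with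
the compactly generated topology associated with the product topology. -/
def CGPow (X : Type w) (m : ℕ) : Type w := Fin m → X

instance (X : Type w) [TopologicalSpace X] (m : ℕ) : TopologicalSpace (CGPow X m) :=
  TopologicalSpace.compactlyGenerated.{w} (Fin m → X)

/-- A simplicial space `X` is Segal's when it is a PRmss and, for every `m ≥ 0`, the map
`p_m = ⟨i_1, …, i_m⟩ : X_m → (X_1)^m` is a homotopy equivalence. For `m = 0` this map is the unique
map to the one-point space. -/
def IsSegalSimplicialSpace (X : SimplexCategoryᵒᵖ ⥤ TopCat.{w}) : Prop :=
  IsPRmss (n := 1) (Pi.eval (fun _ : Fin 1 => SimplexCategoryᵒᵖ) 0 ⋙ X) ∧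
  ∀ m : ℕ, ∃ e : ContinuousMap.HomotopyEquiv (X.obj (op (SimplexCategory.mk m)))
      (CGPow (X.obj (op (SimplexCategory.mk 1))) m),
    ∀ (x : X.obj (op (SimplexCategory.mk m))) (j : Fin m), e.toFun x j = X.map (proj j) x

/-- A multisimplicial space `X` is Segal's when it is a PRmss and, for all `0 ≤ l ≤ n - 1` and
`k ≥ 0`, the simplicial space `X_{1…1 _ k…k}`, with `l` ones, is Segal's. -/
def IsSegalMultisimplicialSpace {n : ℕ} (X : DeltaPow n ⥤ TopCat.{w}) : Prop :=
  IsPRmss X ∧ ∀ (l : Fin n) (k : ℕ), IsSegalSimplicialSpace (line l k ⋙ X)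

/-! ### Classifying spaces -/

/-- The nerve functor, with values in simplicial spaces with discrete values. -/
def nerveSpace : Cat.{v, u} ⥤ (SimplexCategoryᵒᵖ ⥤ TopCat.{max u v}) :=
  nerveFunctor.{v, u} ⋙ (Functor.whiskeringRight _ _ _).obj TopCat.discrete

/-- The classifying space functor `B`, the realization of the nerve. -/
def classifyingSpace : Cat.{v, u} ⥤ TopCat.{max u v} :=
  nerveSpace ⋙ realization

/-! ### Lax functors and rectification -/

/-- Lax functors from a category to the 2-category of small categories, with comparison
transformations `W(g) ∘ W(f) ⟶ W(g ∘ f)` and `id ⟶ W(id)`. -/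
abbrev LaxToCat (A : Type w) [Category.{w} A] := LaxFunctor (LocallyDiscrete A) Cat.{v, u}

/-- A functor to `Cat`, considered as a lax functor. -/
abbrev laxOfFunctor {A : Type w} [SmallCategory A] (V : A ⥤ Cat.{v, u}) : LaxToCat.{v, u} A :=
  V.toPseudofunctor'.toLax

/-- The restriction of a lax functor along a functor. -/
abbrev restrict {A A' : Type w} [SmallCategory A] [SmallCategory A'] (G : A' ⥤ A)
    (W : LaxToCat.{v, u} A) : LaxToCat.{v, u} A' :=
  G.toPseudofunctor.toLax.comp W

/-- `V` is a rectification of the lax functor `W`: there are a left lax transformation `E : V → W`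
(with structure transformations `E_f : W(f) ∘ E_A ⟶ E_B ∘ V(f)`) and a right lax transformation
`J : W → V` (with structure transformations `J_f : J_B ∘ W(f) ⟶ V(f) ∘ J_A`), where `J` is left
adjoint to `E` and `W = E V J`. The adjunction is required componentwise, `J_A ⊣ E_A` for all `A`,
and the equality on arrows, `W(f) = E_B ∘ V(f) ∘ J_A` for all `f : A ⟶ B`. If moreover the structure
transformations of `E` and `J` correspond to each other under these adjunctions, or the comparison
transformations of `W` are those of `E V J`, then `V` is a rectification in this sense as well. -/
def IsRectification {A : Type w} [SmallCategory A] (V : A ⥤ Cat.{v, u}) (W : LaxToCat.{v, u} A) :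
    Prop :=
  ∃ (E : Lax.LaxTrans (laxOfFunctor V) W) (J : Lax.OplaxTrans W (laxOfFunctor V)),
    (∀ a, Nonempty ((J.app a).toFunctor ⊣ (E.app a).toFunctor)) ∧
    ∀ ⦃a b : LocallyDiscrete A⦄ (f : a ⟶ b),
      W.map f = J.app a ≫ (laxOfFunctor V).map f ≫ E.app b

/-- The functor `p_m = ⟨i_1, …, i_m⟩ : W_m → (W_1)^m`. For `m = 0` it is the unique functor to the
terminal category. -/
def segalFunctor (W : LaxToCat.{v, u} SimplexCategoryᵒᵖ) (m : ℕ) :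
    W.obj ⟨op (SimplexCategory.mk m)⟩ ⟶ Cat.of (Fin m → W.obj ⟨op (SimplexCategory.mk 1)⟩) :=
  (Functor.pi' fun j : Fin m => (W.map (proj j).toLoc).toFunctor).toCatHom

/-- A lax functor `W : Δᵒᵖ → Cat` is Segal's when, for every `m ≥ 0`, the functor `p_m` identifies
the category `W_m` with the power `(W_1)^m`, i.e. it is an isomorphism of categories. -/
def IsSegalSimplicialLax (W : LaxToCat.{v, u} SimplexCategoryᵒᵖ) : Prop :=
  ∀ m : ℕ, IsIso (segalFunctor W m)

/-- A lax functor `W : (Δᵒᵖ)ⁿ → Cat` is Segal's when, for all `0 ≤ l ≤ n - 1` and `k ≥ 0`, the lax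
functor `W_{1…1 _ k…k}`, with `l` ones, is Segal's. -/
def IsSegalLax {n : ℕ} (W : LaxToCat.{v, u} (DeltaPow n)) : Prop :=
  ∀ (l : Fin n) (k : ℕ), IsSegalSimplicialLax (restrict (line l k) W)

end SegalMultisimplicial

end

/-! A natural transformation between functors gives a homotopy between their classifying maps
(`homotopic_of_natTrans`). Let `P : V_m ⥤ (V_1)^m` be the Segal functor of a slice of `V`. As `W = E
V J` on arrows, sandwiching `P` between `J` and the power of `E` yields the Segal functor `w` of
`W`, which is invertible. So the power of `E`, followed by the inverse of `w` and then by `J`, is a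
homotopy inverse of `P` after realization: both composites are joined to the identity by zigzags of
counits (`exists_homotopyEquiv_geomMap`). Composing with the homeomorphism `classifyingPow` from the
classifying space of a power to the compactly generated power gives the Segal map of `B ∘ V`.

The topological inputs, homotopies and powers, both rest on inverting the canonical map from the
realization of a product to the product of the realizations. Barycentric coordinates are read as
probability measures on finite chains. Two such measures have a unique joint measure carried by a
chain of the product order, their comonotone coupling: `exists_coupling` gives existence,
`stdSimplex_map_prod_eq` uniqueness. By `ChainFamily.point_eq` that measure determines a point of
the realization, which defines `prodSet.pair`. -/

noncomputable section

namespace SegalMultisimplicial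

/-! ### Barycentric coordinates and monotone maps -/

section Simplex

variable {P Q R : Type*} [Fintype P] [Fintype Q] [Fintype R]

theorem stdSimplex_map_apply [DecidableEq Q] (f : P → Q) (s : stdSimplex ℝ P) (q : Q) :
    stdSimplex.map f s q = ∑ p with f p = q, s p := by
  rw [stdSimplex.map_coe, FunOnFinite.linearMap_apply_apply]

theorem sum_stdSimplex_map (f : P → Q) (s : stdSimplex ℝ P) (A : Q → Prop) [DecidablePred A] :
    ∑ q with A q, stdSimplex.map f s q = ∑ p with A (f p), s p := by
  classical
  simp_rw [stdSimplex_map_apply]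
  rw [← Finset.sum_fiberwise_of_maps_to (s := Finset.univ.filter fun p => A (f p))
    (t := Finset.univ.filter A) (g := f) (by simp)]
  refine Finset.sum_congr rfl fun q hq => Finset.sum_congr ?_ fun _ _ => rfl
  ext p
  simp only [Finset.mem_filter, Finset.mem_univ, true_and] at hq ⊢
  exact ⟨fun h => ⟨h ▸ hq, h⟩, fun h => h.2⟩

theorem stdSimplex_map_ne_zero_iff (f : P → Q) (s : stdSimplex ℝ P) (q : Q) :
    stdSimplex.map f s q ≠ 0 ↔ ∃ p, f p = q ∧ s p ≠ 0 := by
  classical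
  rw [stdSimplex_map_apply, Ne, Finset.sum_eq_zero_iff_of_nonneg (fun p _ => stdSimplex.zero_le s p)]
  simp

theorem stdSimplex_map_injective {f : P → Q} (hf : Function.Injective f) :
    Function.Injective (stdSimplex.map (S := ℝ) f) := by
  classical
  intro s t h
  ext p
  have := DFunLike.congr_fun h (f p)
  simpa [stdSimplex_map_apply, hf.eq_iff, Finset.sum_filter] using this

/-- A function on a finite partial order is determined by its sums over principal lower sets. -/
theorem eq_of_sum_le_eq [PartialOrder R] [DecidableLE R] {f g : R → ℝ}
    (h : ∀ r, ∑ r' with r' ≤ r, f r' = ∑ r' with r' ≤ r, g r') : f = g := by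
  classical
  funext r
  induction r using WellFoundedLT.induction with
  | ind r ih =>
    have hs : (Finset.univ.filter fun r' : R => r' ≤ r) =
        insert r (Finset.univ.filter fun r' : R => r' < r) := by
      ext r'
      simp [le_iff_eq_or_lt]
    have hr := h r
    rw [hs, Finset.sum_insert (by simp), Finset.sum_insert (by simp)] at hr
    have : ∑ r' with r' < r, f r' = ∑ r' with r' < r, g r' :=
      Finset.sum_congr rfl fun r' hr' => ih r' (by simpa using hr')
    linarith

/-- Lower sets of a linear order are nested, so the measure of their intersection is the minimum
of their measures. -/
theorem sum_lower_inter {I : Type*} [Fintype I] [LinearOrder I] (s : stdSimplex ℝ I)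
    (A B : I → Prop) [DecidablePred A] [DecidablePred B]
    (hA : ∀ i j, i ≤ j → A j → A i) (hB : ∀ i j, i ≤ j → B j → B i) :
    ∑ i with A i ∧ B i, s i = min (∑ i with A i, s i) (∑ i with B i, s i) := by
  have h : (∀ i, A i → B i) ∨ (∀ i, B i → A i) := by
    by_contra! h
    obtain ⟨⟨i, hi, hi'⟩, j, hj, hj'⟩ := h
    rcases le_total i j with hij | hij
    · exact hi' (hB i j hij hj)
    · exact hj' (hA j i hij hi)
  have mono : ∀ (C D : I → Prop) [DecidablePred C] [DecidablePred D], (∀ i, C i → D i) →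
      ∑ i with C i, s i ≤ ∑ i with D i, s i := fun C D _ _ hCD =>
    Finset.sum_le_sum_of_subset_of_nonneg (fun i => by simpa using hCD i)
      fun i _ _ => stdSimplex.zero_le s i
  rcases h with h | h
  · rw [min_eq_left (mono _ _ h)]
    congr 1
    ext i
    simpa using h i
  · rw [min_eq_right (mono _ _ h)]
    congr 1
    ext i
    simpa using h i

/-- Monotone preimages of principal lower sets are lower sets of the chain `I`, hence nested. The
joint distribution function is therefore forced by the marginals. -/
theorem sum_le_stdSimplex_map_prod [LinearOrder P] [LinearOrder Q] {I : Type*} [Fintype I]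
    [LinearOrder I] (a : I →o P) (b : I →o Q) (s : stdSimplex ℝ I) (r : P × Q) :
    ∑ r' with r' ≤ r, stdSimplex.map (a.prod b) s r' =
      min (∑ p with p ≤ r.1, stdSimplex.map a s p) (∑ q with q ≤ r.2, stdSimplex.map b s q) := by
  rw [sum_stdSimplex_map, sum_stdSimplex_map, sum_stdSimplex_map, ← sum_lower_inter]
  · congr 1
  · exact fun i j hij h => (a.monotone hij).trans h
  · exact fun i j hij h => (b.monotone hij).trans h

/-- A measure on a product of linear orders which is the image of a measure on a linear order under
a monotone map is determined by its marginals. -/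
theorem stdSimplex_map_prod_eq [LinearOrder P] [LinearOrder Q] {I J : Type*} [Fintype I] [Fintype J]
    [LinearOrder I] [LinearOrder J] (a : I →o P) (b : I →o Q) (a' : J →o P) (b' : J →o Q)
    (s : stdSimplex ℝ I) (s' : stdSimplex ℝ J)
    (ha : stdSimplex.map a s = stdSimplex.map a' s')
    (hb : stdSimplex.map b s = stdSimplex.map b' s') :
    stdSimplex.map (a.prod b) s = stdSimplex.map (a'.prod b') s' := by
  refine DFunLike.coe_injective (eq_of_sum_le_eq fun r => ?_)
  rw [sum_le_stdSimplex_map_prod, sum_le_stdSimplex_map_prod, ha, hb]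

end Simplex

/-! ### Comonotone couplings of measures on finite chains -/

section Coupling

variable {n m : ℕ}

/-- The measure of the elements less than `i`. -/
def lowerSum (t : stdSimplex ℝ (Fin (n + 1))) (i : ℕ) : ℝ :=
  ∑ j with (j : Fin (n + 1)).val < i, t j

theorem lowerSum_mono (t : stdSimplex ℝ (Fin (n + 1))) : Monotone (lowerSum t) := fun _ _ h =>
  Finset.sum_le_sum_of_subset_of_nonneg (fun i => by simp; omega)
    fun i _ _ => stdSimplex.zero_le t i

theorem lowerSum_zero (t : stdSimplex ℝ (Fin (n + 1))) : lowerSum t 0 = 0 := by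
  simp [lowerSum]

theorem lowerSum_last (t : stdSimplex ℝ (Fin (n + 1))) : lowerSum t (n + 1) = 1 := by
  rw [lowerSum, Finset.filter_true_of_mem (fun i _ => i.2)]
  exact stdSimplex.sum_eq_one t

theorem lowerSum_succ (t : stdSimplex ℝ (Fin (n + 1))) (i : Fin (n + 1)) :
    lowerSum t (i + 1) = lowerSum t i + t i := by
  have : (Finset.univ.filter fun j : Fin (n + 1) => j.val < i + 1) =
      insert i (Finset.univ.filter fun j : Fin (n + 1) => j.val < i) := by
    ext j
    simp [Fin.ext_iff]
    omega
  rw [lowerSum, this, Finset.sum_insert (by simp), lowerSum, add_comm]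

/-- The length of the intersection of two intervals. -/
def overlap (a b c d : ℝ) : ℝ := max 0 (min b d - max a c)

theorem overlap_comm (a b c d : ℝ) : overlap a b c d = overlap c d a b := by
  rw [overlap, overlap, min_comm, max_comm a c]

/-- Clamping to `[a, b]` turns the overlap into a difference, so sums over consecutive intervals
telescope. -/
theorem overlap_eq {a b c d : ℝ} (hab : a ≤ b) (hcd : c ≤ d) :
    overlap a b c d = max a (min b d) - max a (min b c) := by
  unfold overlap
  grind

theorem sum_overlap (t : stdSimplex ℝ (Fin (n + 1))) {a b : ℝ} (ha : 0 ≤ a) (hab : a ≤ b)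
    (hb : b ≤ 1) :
    ∑ j : Fin (n + 1), overlap a b (lowerSum t j) (lowerSum t (j + 1)) = b - a := by
  have h : ∀ j : Fin (n + 1), overlap a b (lowerSum t j) (lowerSum t (j + 1)) =
      (fun k : ℕ => max a (min b (lowerSum t (k + 1))) - max a (min b (lowerSum t k))) j :=
    fun j => overlap_eq hab (lowerSum_mono t (Nat.le_succ _))
  rw [Finset.sum_congr rfl fun j _ => h j, Fin.sum_univ_eq_sum_range
      (fun k : ℕ => max a (min b (lowerSum t (k + 1))) - max a (min b (lowerSum t k))) (n + 1),
    Finset.sum_range_sub fun k : ℕ => max a (min b (lowerSum t k)), lowerSum_last, lowerSum_zero]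
  grind

/-- The comonotone coupling of two measures on finite linear orders. -/
def coupling (t : stdSimplex ℝ (Fin (n + 1))) (s : stdSimplex ℝ (Fin (m + 1)))
    (r : Fin (n + 1) × Fin (m + 1)) : ℝ :=
  overlap (lowerSum t r.1) (lowerSum t (r.1 + 1)) (lowerSum s r.2) (lowerSum s (r.2 + 1))

theorem sum_coupling_snd (t : stdSimplex ℝ (Fin (n + 1))) (s : stdSimplex ℝ (Fin (m + 1)))
    (i : Fin (n + 1)) : ∑ j, coupling t s (i, j) = t i := by
  have h := lowerSum_succ t i
  have h0 : 0 ≤ lowerSum t i := lowerSum_zero t ▸ lowerSum_mono t (Nat.zero_le _)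
  have h1 : lowerSum t (i + 1) ≤ 1 := lowerSum_last t ▸ lowerSum_mono t (by omega)
  simp only [coupling]
  rw [sum_overlap s h0 (lowerSum_mono t (Nat.le_succ _)) h1, h]
  ring

theorem sum_coupling_fst (t : stdSimplex ℝ (Fin (n + 1))) (s : stdSimplex ℝ (Fin (m + 1)))
    (j : Fin (m + 1)) : ∑ i, coupling t s (i, j) = s j := by
  rw [← sum_coupling_snd s t j]
  exact Finset.sum_congr rfl fun i _ => overlap_comm _ _ _ _

theorem coupling_nonneg (t : stdSimplex ℝ (Fin (n + 1))) (s : stdSimplex ℝ (Fin (m + 1)))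
    (r : Fin (n + 1) × Fin (m + 1)) : 0 ≤ coupling t s r := le_max_left _ _

/-- Two intervals with nonzero overlap meet in more than a point, and the intervals of each
subdivision are ordered by their indices. Hence the support of the coupling is a chain. -/
theorem snd_le_of_coupling_ne_zero {t : stdSimplex ℝ (Fin (n + 1))}
    {s : stdSimplex ℝ (Fin (m + 1))} {r r' : Fin (n + 1) × Fin (m + 1)}
    (hr : coupling t s r ≠ 0) (hr' : coupling t s r' ≠ 0) (h : r.1 < r'.1) : r.2 ≤ r'.2 := by
  have key : ∀ {a b c d : ℝ}, overlap a b c d ≠ 0 → c < b ∧ a < d := by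
    intro a b c d h
    unfold overlap at h
    grind
  have h1 := (key hr).1
  have h2 := (key hr').2
  have h3 := lowerSum_mono t (show (r.1 : ℕ) + 1 ≤ r'.1 from h)
  by_contra! h4
  have h5 := lowerSum_mono s (show (r'.2 : ℕ) + 1 ≤ r.2 from h4)
  linarith

/-- Every pair of points of simplices comes from a point of a simplex of the product. -/
theorem exists_coupling (t : stdSimplex ℝ (Fin (n + 1))) (s : stdSimplex ℝ (Fin (m + 1))) :
    ∃ (k : ℕ) (a : Fin (k + 1) →o Fin (n + 1)) (b : Fin (k + 1) →o Fin (m + 1))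
      (σ : stdSimplex ℝ (Fin (k + 1))), stdSimplex.map a σ = t ∧ stdSimplex.map b σ = s := by
  classical
  -- The support is a chain of the product order, so its lexicographic enumeration `e` is monotone
  -- in both coordinates. The weights of `σ` are the values of the coupling along `e`.
  let S : Finset (Fin (n + 1) ×ₗ Fin (m + 1)) :=
    Finset.univ.filter fun r => coupling t s (ofLex r) ≠ 0
  have total : ∑ r, coupling t s r = 1 := by
    rw [Fintype.sum_prod_type, Finset.sum_congr rfl fun i _ => sum_coupling_snd t s i]
    exact stdSimplex.sum_eq_one t
  have sumS : ∀ (A : Fin (n + 1) × Fin (m + 1) → Prop) [DecidablePred A],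
      ∑ r ∈ S with A (ofLex r), coupling t s (ofLex r) = ∑ r with A r, coupling t s r := by
    intro A _
    rw [← Finset.sum_filter_ne_zero (s := Finset.univ.filter A)]
    refine Finset.sum_bij' (fun r _ => ofLex r) (fun r _ => toLex r) ?_ ?_ ?_ ?_ ?_ <;>
      simp [S, and_comm]
  have hS : S.Nonempty := by
    by_contra h
    rw [Finset.not_nonempty_iff_eq_empty] at h
    have := sumS fun _ => True
    simp [h, total] at this
  obtain ⟨k, hk⟩ : ∃ k, S.card = k + 1 := ⟨S.card - 1, by have := hS.card_pos; omega⟩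
  let e := S.orderIsoOfFin hk
  have he : ∀ i, coupling t s (ofLex (e i).1) ≠ 0 := fun i => (Finset.mem_filter.1 (e i).2).2
  have sumE : ∀ (A : Fin (n + 1) × Fin (m + 1) → Prop) [DecidablePred A],
      ∑ i with A (ofLex (e i).1), coupling t s (ofLex (e i).1) = ∑ r with A r, coupling t s r := by
    intro A _
    rw [← sumS A]
    refine Finset.sum_bij (fun i _ => (e i).1) ?_ ?_ ?_ ?_
    · intro i hi
      simpa using hi
    · intro i _ j _ h
      exact e.injective (Subtype.ext h)
    · intro r hr
      simp only [Finset.mem_filter] at hr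
      exact ⟨e.symm ⟨r, hr.1⟩, by simpa using hr.2, by simp⟩
    · intros; rfl
  have hlex : ∀ {i j}, i ≤ j → toLex (ofLex (e i).1) ≤ toLex (ofLex (e j).1) :=
    fun h => e.monotone h
  have h1 : Monotone fun i => (ofLex (e i).1).1 := fun i j hij => by
    rcases Prod.Lex.toLex_le_toLex.1 (hlex hij) with h | h
    · exact h.le
    · exact h.1.le
  have h2 : Monotone fun i => (ofLex (e i).1).2 := fun i j hij => by
    rcases Prod.Lex.toLex_le_toLex.1 (hlex hij) with h | h
    · exact snd_le_of_coupling_ne_zero (he i) (he j) h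
    · exact h.2
  refine ⟨k, ⟨_, h1⟩, ⟨_, h2⟩, ⟨fun i => coupling t s (ofLex (e i).1),
    fun i => coupling_nonneg _ _ _, ?_⟩, ?_, ?_⟩
  · have := sumE fun _ => True
    simpa [total] using this
  · ext p
    rw [stdSimplex_map_apply]
    refine (sumE fun r => r.1 = p).trans ?_
    rw [← sum_coupling_snd t s p, Finset.sum_filter, Fintype.sum_prod_type, Finset.sum_eq_single p]
    · simp
    · intro i _ hi
      simp [hi]
    · simp
  · ext p
    rw [stdSimplex_map_apply]
    refine (sumE fun r => r.2 = p).trans ?_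
    rw [← sum_coupling_fst t s p, Finset.sum_filter, Fintype.sum_prod_type]
    simp

end Coupling

/-! ### Realization of simplicial sets -/

/-- The simplicial space with discrete values associated with a simplicial set. -/
abbrev discreteSpace (X : SSet.{w}) : SimplexCategoryᵒᵖ ⥤ TopCat.{w} := X ⋙ TopCat.discrete

/-- The geometric realization of a simplicial set. -/
abbrev Geom (X : SSet.{w}) : Type w := Realization (discreteSpace X)

namespace Geom

variable {X Y Z : SSet.{w}}

/-- The point of the realization given by a simplex and barycentric coordinates. -/
def mk {k : SimplexCategory} (x : X.obj (op k)) (σ : stdSimplex ℝ (Fin (k.len + 1))) : Geom X :=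
  Quot.mk _ ⟨k, x, σ⟩

theorem exists_mk (z : Geom X) : ∃ (k : SimplexCategory) (x : X.obj (op k))
    (σ : stdSimplex ℝ (Fin (k.len + 1))), z = mk x σ := by
  obtain ⟨⟨k, x, σ⟩, rfl⟩ := Quot.exists_rep z
  exact ⟨k, x, σ, rfl⟩

theorem mk_map {k l : SimplexCategory} (f : k ⟶ l) (x : X.obj (op l))
    (σ : stdSimplex ℝ (Fin (k.len + 1))) :
    mk (X.map f.op x) σ = mk x (stdSimplex.map f.toOrderHom σ) :=
  Quot.sound (RealizationRel.glue (X := discreteSpace X) f x σ)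

theorem continuous_mk {k : SimplexCategory} (x : X.obj (op k)) : Continuous (mk x) := by
  refine continuous_quot_mk.comp ?_
  exact (continuous_sigmaMk (σ := fun n : SimplexCategory =>
    (discreteSpace X).obj (op n) × SimplexCategory.toTop₀.obj n)).comp
      (continuous_const.prodMk continuous_id)

theorem continuous_iff {T : Type*} [TopologicalSpace T] {f : Geom X → T} :
    Continuous f ↔ ∀ (k : SimplexCategory) (x : X.obj (op k)), Continuous fun σ => f (mk x σ) := by
  refine ⟨fun h k x => h.comp (continuous_mk x), fun h => ?_⟩
  refine isQuotientMap_quot_mk.continuous_iff.2 (continuous_sigma fun k => ?_)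
  have : DiscreteTopology ((discreteSpace X).obj (op k)) := ⟨rfl⟩
  exact continuous_prod_of_discrete_left.2 fun x => h k x

/-- The map of realizations induced by a simplicial map. -/
def map (φ : X ⟶ Y) : Geom X → Geom Y :=
  Realization.map (Functor.whiskerRight φ TopCat.discrete)

theorem continuous_map (φ : X ⟶ Y) : Continuous (map φ) := Realization.continuous_map _

theorem map_comp_apply (φ : X ⟶ Y) (ψ : Y ⟶ Z) (z : Geom X) :
    map (φ ≫ ψ) z = map ψ (map φ z) := by
  obtain ⟨k, x, σ, rfl⟩ := exists_mk z
  rfl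

theorem map_id_apply (z : Geom X) : map (𝟙 X) z = z := by
  obtain ⟨k, x, σ, rfl⟩ := exists_mk z
  rfl

end Geom

/-! ### Families of simplices indexed by chains of a partial order -/

/-- A family of simplices of `Z`, indexed by the chains of a partial order `R`, i.e. a map from the
nerve of `R` to `Z`. -/
structure ChainFamily (R : Type) [PartialOrder R] (Z : SSet.{w}) where
  simplex : ∀ {k : SimplexCategory}, (Fin (k.len + 1) →o R) → Z.obj (op k)
  simplex_comp : ∀ {k l : SimplexCategory} (f : k ⟶ l) (a : Fin (l.len + 1) →o R),
    simplex (a.comp f.toOrderHom) = Z.map f.op (simplex a)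

namespace ChainFamily

variable {R : Type} [PartialOrder R] {Z : SSet.{w}} (φ : ChainFamily R Z)

/-- The point of the realization given by a chain and barycentric coordinates. -/
def point (k : ℕ) (a : Fin (k + 1) →o R) (σ : stdSimplex ℝ (Fin (k + 1))) : Geom Z :=
  Geom.mk (φ.simplex (k := .mk k) a) σ

theorem continuous_point (k : ℕ) (a : Fin (k + 1) →o R) : Continuous (φ.point k a) :=
  Geom.continuous_mk _

theorem point_comp {k l : ℕ} (f : Fin (k + 1) →o Fin (l + 1)) (a : Fin (l + 1) →o R)
    (σ : stdSimplex ℝ (Fin (k + 1))) :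
    φ.point k (a.comp f) σ = φ.point l a (stdSimplex.map f σ) := by
  have h := Geom.mk_map (SimplexCategory.Hom.mk (a := .mk k) (b := .mk l) f)
    (φ.simplex (k := .mk l) a) σ
  rw [← φ.simplex_comp] at h
  exact h

variable [Fintype R]

/-- Every point given by a chain is given by a strictly monotone chain with positive weights. -/
theorem exists_strictMono (k : ℕ) (a : Fin (k + 1) →o R) (σ : stdSimplex ℝ (Fin (k + 1))) :
    ∃ (q : ℕ) (c : Fin (q + 1) →o R) (τ : stdSimplex ℝ (Fin (q + 1))), StrictMono c ∧
      (∀ i, τ i ≠ 0) ∧ stdSimplex.map c τ = stdSimplex.map a σ ∧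
        φ.point q c τ = φ.point k a σ := by
  induction k with
  | zero =>
    refine ⟨0, a, σ, fun i j h => absurd h (by omega), fun i hi => ?_, rfl, rfl⟩
    have h := stdSimplex.sum_eq_one σ
    rw [Fin.sum_univ_one, ← Fin.eq_zero i, hi] at h
    exact zero_ne_one h
  | succ k ih =>
    by_cases hσ : ∃ i, σ i = 0
    -- A vertex of weight zero is dropped: `σ` lies on the face `δ` opposite to it.
    · obtain ⟨i, hi⟩ := hσ
      have hsum : σ i + ∑ j, σ (i.succAbove j) = 1 := by
        rw [← Fin.sum_univ_succAbove]
        exact stdSimplex.sum_eq_one σ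
      let σ' : stdSimplex ℝ (Fin (k + 1)) := ⟨fun j => σ (i.succAbove j),
        fun j => stdSimplex.zero_le σ _, by linarith⟩
      let δ : Fin (k + 1) →o Fin (k + 1 + 1) := i.succAboveOrderEmb.toOrderHom
      have hσ' : stdSimplex.map δ σ' = σ := by
        ext j
        rw [stdSimplex_map_apply]
        rcases eq_or_ne j i with rfl | hj
        · rw [hi]
          refine Finset.sum_eq_zero fun l hl => ?_
          exact absurd (Finset.mem_filter.1 hl).2 (Fin.succAbove_ne j l)
        · obtain ⟨l, rfl⟩ := Fin.exists_succAbove_eq hj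
          have : ∀ x, δ x = i.succAbove l ↔ x = l := fun x => Fin.succAbove_right_inj
          simp only [this, Finset.sum_filter, Finset.sum_ite_eq', Finset.mem_univ, if_true]
          rfl
      obtain ⟨q, c, τ, h1, h2, h3, h4⟩ := ih (a.comp δ) σ'
      refine ⟨q, c, τ, h1, h2, ?_, ?_⟩
      · rw [h3, ← hσ', stdSimplex.map_comp_apply]
        rfl
      · rw [h4, φ.point_comp, hσ']
    · by_cases ha : StrictMono a
      · exact ⟨k + 1, a, σ, ha, fun i hi => hσ ⟨i, hi⟩, rfl, rfl⟩
      -- Two adjacent equal elements of the chain are merged: `a` factors through the codegeneracy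
      -- `s`, which adds up their weights.
      · rw [Fin.strictMono_iff_lt_succ] at ha
        push Not at ha
        obtain ⟨i, hi⟩ := ha
        have hi : a i.castSucc = a i.succ :=
          (a.monotone (Fin.castSucc_lt_succ (i := i)).le).eq_of_not_lt hi
        let δ : Fin (k + 1) →o Fin (k + 1 + 1) := i.succ.succAboveOrderEmb.toOrderHom
        let s : Fin (k + 1 + 1) →o Fin (k + 1) := ⟨i.predAbove, Fin.predAbove_right_monotone i⟩
        have has : (a.comp δ).comp s = a := by
          ext j
          change a (i.succ.succAbove (i.predAbove j)) = a j
          rcases eq_or_ne j i.succ with rfl | hj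
          · rw [Fin.predAbove_succ_self, Fin.succAbove_succ_self]
            exact hi
          · rw [Fin.succ_succAbove_predAbove hj]
        obtain ⟨q, c, τ, h1, h2, h3, h4⟩ := ih (a.comp δ) (stdSimplex.map s σ)
        refine ⟨q, c, τ, h1, h2, ?_, ?_⟩
        · rw [h3, stdSimplex.map_comp_apply]
          congr 1
          exact congrArg DFunLike.coe has
        · rw [h4, ← φ.point_comp, has]

/-- The point given by a chain and weights only depends on the resulting measure. -/
theorem point_eq {k l : ℕ} (a : Fin (k + 1) →o R) (b : Fin (l + 1) →o R)
    (σ : stdSimplex ℝ (Fin (k + 1))) (τ : stdSimplex ℝ (Fin (l + 1)))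
    (h : stdSimplex.map a σ = stdSimplex.map b τ) : φ.point k a σ = φ.point l b τ := by
  obtain ⟨k, a, σ, ha, hσ, ha', h1⟩ := φ.exists_strictMono k a σ
  obtain ⟨l, b, τ, hb, hτ, hb', h2⟩ := φ.exists_strictMono l b τ
  rw [← ha', ← hb'] at h
  rw [← h1, ← h2]
  -- With nonzero weights, the range of a chain is the support of its measure, and a strictly
  -- monotone chain is determined by its range.
  have hrange : Set.range a = Set.range b := by
    ext r
    have := iff_of_eq (congrArg (fun μ => μ r ≠ 0) (congrArg DFunLike.coe h))
    rw [stdSimplex_map_ne_zero_iff, stdSimplex_map_ne_zero_iff] at this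
    exact ⟨fun ⟨i, hi⟩ => (this.1 ⟨i, hi, hσ i⟩).imp fun _ => And.left,
      fun ⟨i, hi⟩ => (this.2 ⟨i, hi, hτ i⟩).imp fun _ => And.left⟩
  have hkl : k = l := by
    have := congrArg Set.ncard hrange
    rw [← Set.image_univ, ← Set.image_univ, Set.ncard_image_of_injective _ ha.injective,
      Set.ncard_image_of_injective _ hb.injective] at this
    simpa using this
  subst hkl
  have hab : a = b := DFunLike.coe_injective ((ha.range_inj hb).1 hrange)
  subst hab
  rw [stdSimplex_map_injective ha.injective h]

end ChainFamily

/-! ### Continuity on compact Hausdorff test spaces -/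

open Topology

/-- The family of all compact Hausdorff spaces. -/
abbrev testSpaces : CompHaus.{w} → Type w := fun K => K

theorem locallyCompactSpace_of_compactSpace (K : Type*) [TopologicalSpace K] [CompactSpace K]
    [T2Space K] : LocallyCompactSpace K := inferInstance

instance (K : CompHaus.{w}) : LocallyCompactSpace (testSpaces K) :=
  locallyCompactSpace_of_compactSpace K

instance (K L : CompHaus.{w}) : IsGeneratedBy testSpaces.{w} (testSpaces K × testSpaces L) :=
  inferInstanceAs (IsGeneratedBy testSpaces.{w} (testSpaces (CompHaus.of (K × L))))

theorem isGeneratedBy_of_compactSpace (K : Type) [TopologicalSpace K] [CompactSpace K] [T2Space K] :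
    IsGeneratedBy testSpaces.{w} K :=
  have : IsGeneratedBy testSpaces.{w} (ULift.{w} K) :=
    inferInstanceAs (IsGeneratedBy testSpaces.{w} (testSpaces (CompHaus.of (ULift.{w} K))))
  (Homeomorph.ulift.{w} (X := K)).isQuotientMap.isGeneratedBy

/-- The realization is a quotient of a disjoint union of simplices, which are compact. -/
theorem Geom.isGeneratedBy (X : SSet.{w}) : IsGeneratedBy testSpaces.{w} (Geom X) := by
  have : ∀ k : SimplexCategory, IsGeneratedBy testSpaces.{w}
      ((discreteSpace X).obj (op k) × SimplexCategory.toTop₀.obj k) := by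
    intro k
    have : DiscreteTopology ((discreteSpace X).obj (op k)) := ⟨rfl⟩
    have : IsGeneratedBy testSpaces.{w} (stdSimplex ℝ (Fin (k.len + 1))) :=
      isGeneratedBy_of_compactSpace _
    refine IsQuotientMap.isGeneratedBy (Y := Σ _ : (discreteSpace X).obj (op k),
      stdSimplex ℝ (Fin (k.len + 1))) (f := fun z => (z.1, z.2)) ?_
    have h : Continuous fun z : (discreteSpace X).obj (op k) × stdSimplex ℝ (Fin (k.len + 1)) =>
        (⟨z.1, z.2⟩ : Σ _ : (discreteSpace X).obj (op k), stdSimplex ℝ (Fin (k.len + 1))) :=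
      continuous_prod_of_discrete_left.2 fun x => continuous_sigmaMk
        (σ := fun _ : (discreteSpace X).obj (op k) => stdSimplex ℝ (Fin (k.len + 1)))
    exact IsQuotientMap.of_inverse h
      (continuous_sigma fun x => continuous_const.prodMk continuous_id) fun z => rfl
  exact Quot.isGeneratedBy

theorem continuousGeneratedBy_swap {A B C : Type*} [TopologicalSpace A] [TopologicalSpace B]
    [TopologicalSpace C] {f : A × B → C} (h : ContinuousGeneratedBy testSpaces.{w} f) :
    ContinuousGeneratedBy testSpaces.{w} fun p : B × A => f (p.2, p.1) :=
  fun _ g => h (ContinuousMap.comp ⟨Prod.swap, continuous_swap⟩ g)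

/-- To check the continuity on test spaces of a map of two variables, the first of which varies in
a realization, it suffices to consider the cells. -/
theorem Geom.continuousGeneratedBy_prod {X : SSet.{w}} {S T : Type*} [TopologicalSpace S]
    [TopologicalSpace T] {g : Geom X × S → T}
    (h : ∀ (k : SimplexCategory) (x : X.obj (op k)), ContinuousGeneratedBy testSpaces.{w}
      fun p : stdSimplex ℝ (Fin (k.len + 1)) × S => g (Geom.mk x p.1, p.2)) :
    ContinuousGeneratedBy testSpaces.{w} g := by
  have hz : ∀ z, ContinuousGeneratedBy testSpaces.{w} fun y => g (z, y) := by
    intro z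
    obtain ⟨k, x, σ, rfl⟩ := exists_mk z
    exact (h k x).comp (continuous_const.prodMk continuous_id).continuousGeneratedBy
  -- A product with `S` need not preserve the quotient map onto `Geom X`. After currying, `Geom X`
  -- alone is the source and its quotient topology applies.
  let G : Geom X → ContinuousMapGeneratedBy testSpaces.{w} S T := fun z => ⟨_, hz z⟩
  have hG : Continuous G := by
    refine Geom.continuous_iff.2 fun k x => ?_
    have := isGeneratedBy_of_compactSpace.{w} (stdSimplex ℝ (Fin (k.len + 1)))
    let F : ContinuousMapGeneratedBy testSpaces.{w} (S × stdSimplex ℝ (Fin (k.len + 1))) T :=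
      ⟨fun p => g (mk x p.2, p.1), continuousGeneratedBy_swap (h k x)⟩
    exact (IsGeneratedBy.continuous_iff testSpaces.{w} _).2
      (ContinuousMapGeneratedBy.curryEquiv F).prop
  exact continuousGeneratedBy_swap (ContinuousMapGeneratedBy.curryEquiv.symm
    ⟨G, hG.continuousGeneratedBy⟩).prop

/-! ### Products of realizations -/

/-- The arrow of `Δ` given by a monotone map. -/
abbrev monotoneArrow {k n : SimplexCategory} (a : Fin (k.len + 1) →o Fin (n.len + 1)) : k ⟶ n :=
  SimplexCategory.Hom.mk a

/-- The product of two simplicial sets. -/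
def prodSet (X Y : SSet.{w}) : SSet.{w} where
  obj k := X.obj k × Y.obj k
  map f := ↾fun z => (X.map f z.1, Y.map f z.2)

namespace prodSet

variable (X Y : SSet.{w})

/-- The first projection. -/
def fst : prodSet X Y ⟶ X where
  app _ := ↾Prod.fst

/-- The second projection. -/
def snd : prodSet X Y ⟶ Y where
  app _ := ↾Prod.snd

variable {X Y}

/-- The chains of a product of simplices, as simplices of the product of two simplicial sets. -/
def chainFamily {n m : SimplexCategory} (x : X.obj (op n)) (y : Y.obj (op m)) :
    ChainFamily (Fin (n.len + 1) × Fin (m.len + 1)) (prodSet X Y) where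
  simplex a := (X.map (monotoneArrow (OrderHom.fst.comp a)).op x,
    Y.map (monotoneArrow (OrderHom.snd.comp a)).op y)
  simplex_comp {k l} f a := by
    refine Prod.ext ?_ ?_
    · exact ConcreteCategory.congr_hom
        (X.map_comp (monotoneArrow (OrderHom.fst.comp a)).op f.op) x
    · exact ConcreteCategory.congr_hom
        (Y.map_comp (monotoneArrow (OrderHom.snd.comp a)).op f.op) y

/-- The point of the realization of the product corresponding to two points of simplices. -/
def pairMk {n m : SimplexCategory} (x : X.obj (op n)) (t : stdSimplex ℝ (Fin (n.len + 1)))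
    (y : Y.obj (op m)) (s : stdSimplex ℝ (Fin (m.len + 1))) : Geom (prodSet X Y) :=
  (chainFamily x y).point (exists_coupling t s).choose
    ((exists_coupling t s).choose_spec.choose.prod
      (exists_coupling t s).choose_spec.choose_spec.choose)
    (exists_coupling t s).choose_spec.choose_spec.choose_spec.choose

/-- Independence of the chosen coupling: the marginals determine the joint measure, and that measure
determines the point. -/
theorem pairMk_eq {n m : SimplexCategory} (x : X.obj (op n)) (t : stdSimplex ℝ (Fin (n.len + 1)))
    (y : Y.obj (op m)) (s : stdSimplex ℝ (Fin (m.len + 1))) {k : ℕ}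
    (a : Fin (k + 1) →o Fin (n.len + 1)) (b : Fin (k + 1) →o Fin (m.len + 1))
    (σ : stdSimplex ℝ (Fin (k + 1))) (ha : stdSimplex.map a σ = t) (hb : stdSimplex.map b σ = s) :
    pairMk x t y s = (chainFamily x y).point k (a.prod b) σ := by
  have h := (exists_coupling t s).choose_spec.choose_spec.choose_spec.choose_spec
  exact (chainFamily x y).point_eq _ _ _ _
    (stdSimplex_map_prod_eq _ _ _ _ _ _ (h.1.trans ha.symm) (h.2.trans hb.symm))

/-- Composing one leg of a coupling with `f` gives a coupling of the pushed measure, so one chain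
computes both sides. -/
theorem pairMk_map_left {n n' m : SimplexCategory} (f : n ⟶ n') (x : X.obj (op n'))
    (t : stdSimplex ℝ (Fin (n.len + 1))) (y : Y.obj (op m)) (s : stdSimplex ℝ (Fin (m.len + 1))) :
    pairMk (X.map f.op x) t y s = pairMk x (stdSimplex.map f.toOrderHom t) y s := by
  obtain ⟨k, a, b, σ, ha, hb⟩ := exists_coupling t s
  rw [pairMk_eq _ _ _ _ a b σ ha hb, pairMk_eq _ _ _ _ (f.toOrderHom.comp a) b σ _ hb]
  · unfold ChainFamily.point
    congr 1
    refine Prod.ext ?_ rfl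
    exact (ConcreteCategory.congr_hom
        (X.map_comp f.op (monotoneArrow (k := .mk k) a).op) x).symm
  · rw [← ha, stdSimplex.map_comp_apply]
    rfl

theorem pairMk_map_right {n m m' : SimplexCategory} (f : m ⟶ m') (x : X.obj (op n))
    (t : stdSimplex ℝ (Fin (n.len + 1))) (y : Y.obj (op m')) (s : stdSimplex ℝ (Fin (m.len + 1))) :
    pairMk x t (Y.map f.op y) s = pairMk x t y (stdSimplex.map f.toOrderHom s) := by
  obtain ⟨k, a, b, σ, ha, hb⟩ := exists_coupling t s
  rw [pairMk_eq _ _ _ _ a b σ ha hb, pairMk_eq _ _ _ _ a (f.toOrderHom.comp b) σ ha]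
  · unfold ChainFamily.point
    congr 1
    refine Prod.ext rfl ?_
    exact (ConcreteCategory.congr_hom
        (Y.map_comp f.op (monotoneArrow (k := .mk k) b).op) y).symm
  · rw [← hb, stdSimplex.map_comp_apply]
    rfl

/-- Finitely many simplices of chains cover the product of two simplices. A continuous surjection
from a compact space onto a Hausdorff space is a quotient map, and on each of these simplices the
map is a cell of the realization. -/
theorem continuous_pairMk {n m : SimplexCategory} (x : X.obj (op n)) (y : Y.obj (op m)) :
    Continuous fun p : stdSimplex ℝ (Fin (n.len + 1)) × stdSimplex ℝ (Fin (m.len + 1)) =>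
      pairMk x p.1 y p.2 := by
  let R := Fin (n.len + 1) × Fin (m.len + 1)
  let N := Fintype.card R
  -- A strictly monotone chain has at most `N` elements, so these finitely many monotone maps
  -- include all strict chains.
  let ι := Σ q : Fin N, Fin (q.val + 1) →o R
  have : ∀ q : Fin N, Finite (Fin (q.val + 1) →o R) := fun q => DFunLike.finite _
  have : Finite ι := inferInstance
  let K := Σ i : ι, stdSimplex ℝ (Fin (i.1.val + 1))
  let g : K → stdSimplex ℝ (Fin (n.len + 1)) × stdSimplex ℝ (Fin (m.len + 1)) := fun z =>
    (stdSimplex.map (OrderHom.fst.comp z.1.2) z.2, stdSimplex.map (OrderHom.snd.comp z.1.2) z.2)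
  have hg : Continuous g := continuous_sigma fun i =>
    Continuous.prodMk (f := stdSimplex.map (S := ℝ) (OrderHom.fst.comp i.2))
      (g := stdSimplex.map (S := ℝ) (OrderHom.snd.comp i.2))
      (stdSimplex.continuous_map _) (stdSimplex.continuous_map _)
  have hgs : Function.Surjective g := by
    rintro ⟨t, s⟩
    obtain ⟨k, a, b, σ, ha, hb⟩ := exists_coupling t s
    obtain ⟨q, c, τ, hc, -, hcτ, -⟩ := (chainFamily x y).exists_strictMono k (a.prod b) σ
    have hq : q < N := by
      have := Fintype.card_le_of_injective c hc.injective
      rwa [Fintype.card_fin] at this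
    refine ⟨⟨⟨⟨q, hq⟩, c⟩, τ⟩, Prod.ext ?_ ?_⟩
    · have := congrArg (stdSimplex.map Prod.fst) hcτ
      rw [stdSimplex.map_comp_apply, stdSimplex.map_comp_apply] at this
      exact this.trans ha
    · have := congrArg (stdSimplex.map Prod.snd) hcτ
      rw [stdSimplex.map_comp_apply, stdSimplex.map_comp_apply] at this
      exact this.trans hb
  have hq : IsQuotientMap g := IsQuotientMap.of_surjective_continuous hgs hg
  refine hq.continuous_iff.2 (continuous_sigma fun i => ?_)
  refine ((chainFamily x y).continuous_point i.1 i.2).congr fun τ => ?_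
  exact (pairMk_eq x _ y _ (OrderHom.fst.comp i.2) (OrderHom.snd.comp i.2) τ rfl rfl).symm

/-- The inverse of the canonical map from the realization of a product to the product of the
realizations. -/
def pair (z : Geom X) (z' : Geom Y) : Geom (prodSet X Y) :=
  Quot.lift₂ (fun p q => pairMk p.2.1 p.2.2 q.2.1 q.2.2)
    (by rintro ⟨n, x, t⟩ _ _ ⟨f, y, s⟩; exact pairMk_map_right f x t y s)
    (by rintro _ _ ⟨m, y, s⟩ ⟨f, x, t⟩; exact pairMk_map_left f x t y s) z z'

theorem pair_mk {n m : SimplexCategory} (x : X.obj (op n)) (t : stdSimplex ℝ (Fin (n.len + 1)))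
    (y : Y.obj (op m)) (s : stdSimplex ℝ (Fin (m.len + 1))) :
    pair (Geom.mk x t) (Geom.mk y s) = pairMk x t y s := rfl

theorem pair_mk_eq {n m : SimplexCategory} (x : X.obj (op n)) (y : Y.obj (op m)) {k : ℕ}
    (a : Fin (k + 1) →o Fin (n.len + 1)) (b : Fin (k + 1) →o Fin (m.len + 1))
    (σ : stdSimplex ℝ (Fin (k + 1))) :
    pair (Geom.mk x (stdSimplex.map a σ)) (Geom.mk y (stdSimplex.map b σ)) =
      Geom.mk (X := prodSet X Y) (k := .mk k)
        (X.map (monotoneArrow (k := .mk k) a).op x,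
          Y.map (monotoneArrow (k := .mk k) b).op y) σ :=
  pairMk_eq x _ y _ a b σ rfl rfl

theorem map_fst_pair (z : Geom X) (z' : Geom Y) : Geom.map (fst X Y) (pair z z') = z := by
  obtain ⟨n, x, t, rfl⟩ := Geom.exists_mk z
  obtain ⟨m, y, s, rfl⟩ := Geom.exists_mk z'
  obtain ⟨k, a, b, σ, rfl, rfl⟩ := exists_coupling t s
  rw [pair_mk_eq]
  exact Geom.mk_map (monotoneArrow (k := .mk k) a) x σ

theorem map_snd_pair (z : Geom X) (z' : Geom Y) : Geom.map (snd X Y) (pair z z') = z' := by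
  obtain ⟨n, x, t, rfl⟩ := Geom.exists_mk z
  obtain ⟨m, y, s, rfl⟩ := Geom.exists_mk z'
  obtain ⟨k, a, b, σ, rfl, rfl⟩ := exists_coupling t s
  rw [pair_mk_eq]
  exact Geom.mk_map (monotoneArrow (k := .mk k) b) y σ

/-- For two simplices with the same coordinates, the diagonal chain is a coupling. -/
theorem pair_map (z : Geom (prodSet X Y)) :
    pair (Geom.map (fst X Y) z) (Geom.map (snd X Y) z) = z := by
  obtain ⟨n, ⟨x, y⟩, t, rfl⟩ := Geom.exists_mk z
  have h := pair_mk_eq x y (k := n.len) OrderHom.id OrderHom.id t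
  have ht : stdSimplex.map (OrderHom.id : Fin (n.len + 1) →o _) t = t := stdSimplex.map_id_apply t
  rw [ht] at h
  refine h.trans ?_
  congr 1
  exact Prod.ext (ConcreteCategory.congr_hom (X.map_id (op n)) x)
    (ConcreteCategory.congr_hom (Y.map_id (op n)) y)

theorem continuousGeneratedBy_pair_mk_left {n m : SimplexCategory} (x : X.obj (op n))
    (y : Y.obj (op m)) : ContinuousGeneratedBy testSpaces.{w}
      fun p : stdSimplex ℝ (Fin (m.len + 1)) × stdSimplex ℝ (Fin (n.len + 1)) =>
        pair (Geom.mk x p.2) (Geom.mk y p.1) := by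
  simp only [pair_mk]
  exact Continuous.continuousGeneratedBy ((continuous_pairMk x y).comp continuous_swap)

/-- Continuity is claimed on test spaces only, since the product topology can be coarser than the
compactly generated one. -/
theorem continuousGeneratedBy_pair :
    ContinuousGeneratedBy testSpaces.{w} fun p : Geom X × Geom Y => pair p.1 p.2 := by
  refine Geom.continuousGeneratedBy_prod (g := fun p : Geom X × Geom Y => pair p.1 p.2)
    fun n x => ?_
  exact continuousGeneratedBy_swap (Geom.continuousGeneratedBy_prod
    (g := fun p : Geom Y × stdSimplex ℝ (Fin (n.len + 1)) => pair (Geom.mk x p.2) p.1)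
    fun m y => continuousGeneratedBy_pair_mk_left x y)

/-- If one of the variables is restricted to a simplex, then pairing is continuous. -/
theorem continuous_pair_mk {m : SimplexCategory} (y : Y.obj (op m)) :
    Continuous fun p : Geom X × stdSimplex ℝ (Fin (m.len + 1)) => pair p.1 (Geom.mk y p.2) := by
  have h : ∀ z : Geom X, Continuous fun s => pair z (Geom.mk y s) := by
    intro z
    obtain ⟨n, x, t, rfl⟩ := Geom.exists_mk z
    exact (continuous_pairMk x y).comp (continuous_const.prodMk continuous_id)
  -- The simplex is locally compact, so currying works for the ordinary product topology, as
  -- homotopies require.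
  let G : Geom X → C(stdSimplex ℝ (Fin (m.len + 1)), Geom (prodSet X Y)) := fun z => ⟨_, h z⟩
  have hG : Continuous G := Geom.continuous_iff.2 fun n x =>
    ContinuousMap.continuous_of_continuous_uncurry _ (continuous_pairMk x y)
  exact ContinuousMap.continuous_uncurry_of_continuous ⟨G, hG⟩

end prodSet

/-! ### Powers of realizations -/

/-- The powers of a simplicial set. -/
def powSet (X : SSet.{w}) (m : ℕ) : SSet.{w} where
  obj k := Fin m → X.obj k
  map f := ↾fun z j => X.map f (z j)

namespace powSet

variable (X : SSet.{w}) (m : ℕ)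

/-- The projections of a power. -/
def coord (j : Fin m) : powSet X m ⟶ X where
  app _ := ↾fun z => z j

/-- The map adding a component. -/
def cons : prodSet X (powSet X m) ⟶ powSet X (m + 1) where
  app _ := ↾fun z => (Fin.cons z.1 z.2 : Fin (m + 1) → _)
  naturality k l f := by
    ext z
    refine funext fun j => ?_
    cases j using Fin.cases <;> rfl

/-- The map splitting the first component from the others. -/
def uncons : powSet X (m + 1) ⟶ prodSet X (powSet X m) where
  app _ := ↾fun z => (z 0, fun j => z j.succ)

theorem uncons_cons : uncons X m ≫ cons X m = 𝟙 _ := by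
  ext k z
  refine funext fun j => ?_
  cases j using Fin.cases <;> rfl

/-- The canonical map from the realization of a power to the power of the realization. -/
def split (z : Geom (powSet X m)) (j : Fin m) : Geom X := Geom.map (coord X m j) z

variable {X m}

/-- The inverse of the canonical map from the realization of a power to the power of the
realization. -/
def tuple : (m : ℕ) → (Fin m → Geom X) → Geom (powSet X m)
  | 0, _ => Geom.mk (k := .mk 0) (fun j => j.elim0) (stdSimplex.vertex 0)
  | m + 1, z => Geom.map (cons X m) (prodSet.pair (z 0) (tuple m fun j => z j.succ))

theorem continuousGeneratedBy_tuple (m : ℕ) :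
    ContinuousGeneratedBy testSpaces.{w} (tuple (X := X) m) := by
  induction m with
  | zero => exact fun K f => continuous_const
  | succ m ih =>
    intro K f
    have h : Continuous fun k : K => tuple m fun j : Fin m => f k j.succ :=
      ih ⟨fun k j => f k j.succ, by fun_prop⟩
    have h0 : Continuous fun k : K => f k 0 := by fun_prop
    exact (Geom.continuous_map _).comp
      (prodSet.continuousGeneratedBy_pair (X := X) (Y := powSet X m) ⟨_, h0.prodMk h⟩)

theorem split_tuple (m : ℕ) (z : Fin m → Geom X) : split X m (tuple m z) = z := by
  induction m with
  | zero => exact funext fun j => j.elim0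
  | succ m ih =>
    funext j
    cases j using Fin.cases with
    | zero =>
      refine Eq.trans ?_ (prodSet.map_fst_pair (z 0) (tuple m fun j => z j.succ))
      rw [split, tuple, ← Geom.map_comp_apply]
      rfl
    | succ j =>
      refine Eq.trans ?_ (congrFun (ih fun j => z j.succ) j)
      rw [split, split, tuple, ← Geom.map_comp_apply,
        ← prodSet.map_snd_pair (z 0) (tuple m fun j => z j.succ), ← Geom.map_comp_apply,
        prodSet.map_snd_pair]
      rfl

theorem tuple_split (m : ℕ) (z : Geom (powSet X m)) : tuple m (split X m z) = z := by
  induction m with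
  | zero =>
    obtain ⟨k, x, σ, rfl⟩ := Geom.exists_mk z
    -- The zeroth power has one simplex in each dimension, degenerate on its vertex, so its
    -- realization is a point.
    have h := Geom.mk_map (X := powSet X 0)
      (monotoneArrow (k := k) (n := .mk 0) ⟨fun _ => 0, monotone_const⟩)
      (fun j => j.elim0) σ
    have hx : (powSet X 0).map (monotoneArrow (k := k) (n := .mk 0)
        ⟨fun _ => 0, monotone_const⟩).op (fun j => j.elim0) = x := funext fun j => j.elim0
    rw [hx] at h
    rw [h]
    have : Subsingleton (Fin ((SimplexCategory.mk 0).len + 1)) :=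
      inferInstanceAs (Subsingleton (Fin 1))
    exact congrArg (Geom.mk (X := powSet X 0) (k := .mk 0) fun j => j.elim0) (Subsingleton.elim _ _)
  | succ m ih =>
    have h0 : split X (m + 1) z 0 = Geom.map (prodSet.fst _ _) (Geom.map (uncons X m) z) := by
      rw [← Geom.map_comp_apply]
      rfl
    have h1 : (tuple m fun j => split X (m + 1) z j.succ) =
        Geom.map (prodSet.snd _ _) (Geom.map (uncons X m) z) := by
      rw [← ih (Geom.map (prodSet.snd _ _) (Geom.map (uncons X m) z))]
      congr 1
      funext j
      rw [split, split, ← Geom.map_comp_apply, ← Geom.map_comp_apply]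
      rfl
    rw [tuple, h0, h1, prodSet.pair_map, ← Geom.map_comp_apply, uncons_cons, Geom.map_id_apply]

variable (X m)

/-- A tuple of points, as a point of the compactly generated power. -/
def toCGPow {T : Type w} {m : ℕ} (z : Fin m → T) : CGPow T m := z

/-- The target carries a finer topology than the product, and a source generated by test spaces
makes up for it. -/
theorem continuous_toCGPow {T S : Type w} [TopologicalSpace T] [TopologicalSpace S]
    [IsGeneratedBy testSpaces.{w} S] {f : S → Fin m → T} (hf : Continuous f) :
    Continuous fun s => toCGPow (f s) := by
  refine (IsGeneratedBy.continuous_iff testSpaces.{w} _).2 fun K g => ?_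
  refine continuous_def.2 fun U hU => ?_
  let h : C(K, Fin m → T) := (ContinuousMap.mk f hf).comp g
  exact isOpen_sigma_iff.1 (isOpen_coinduced.1 hU) ⟨K, h⟩

/-- Realization commutes with finite powers. -/
def homeomorph : Geom (powSet X m) ≃ₜ CGPow (Geom X) m where
  toFun z := toCGPow (split X m z)
  invFun z := tuple m z
  left_inv := tuple_split m
  right_inv := split_tuple m
  continuous_toFun :=
    have := Geom.isGeneratedBy (powSet X m)
    continuous_toCGPow m (continuous_pi fun j => Geom.continuous_map (coord X m j))
  continuous_invFun := continuous_from_compactlyGenerated (X := Fin m → Geom X) (tuple m)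
    fun K g => continuousGeneratedBy_tuple (X := X) m (i := K) g

end powSet

/-! ### Homotopies from natural transformations -/

/-- The standard simplex of dimension one. -/
def intervalSet : SSet.{w} where
  obj k := ULift (Fin (k.unop.len + 1) →o Fin 2)
  map f := ↾fun a => ⟨a.down.comp f.unop.toOrderHom⟩

theorem stdSimplex_map_const {P Q : Type*} [Fintype P] [Fintype Q] [DecidableEq Q] (q : Q)
    (s : stdSimplex ℝ P) : stdSimplex.map (fun _ => q) s = stdSimplex.vertex q := by
  ext q'
  rw [stdSimplex_map_apply]
  rcases eq_or_ne q q' with rfl | h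
  · simp
  · simp [h, h.symm]

section Homotopy

variable {C D : Type u} [Category.{v} C] [Category.{v} D]

/-- The map of classifying spaces induced by a functor. -/
def geomMap (F : C ⥤ D) : C(Geom (nerve C), Geom (nerve D)) :=
  ⟨Geom.map (nerveMap F), Geom.continuous_map _⟩

variable {F G : C ⥤ D} (α : F ⟶ G)

/-- The simplicial homotopy between the nerves of two functors which is given by a natural
transformation. -/
def nerveHomotopy : prodSet (nerve C) intervalSet.{max u v} ⟶ nerve D where
  app k := ↾fun z => (Functor.prod' z.2.down.monotone.functor z.1 ⋙
    Functor.uncurry.obj (ComposableArrows.mk₁ α) : ComposableArrows D k.unop.len)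

theorem nerveHomotopy_zero {k : ℕ} (x : ComposableArrows C k) :
    (Functor.prod' (OrderHom.const (Fin (k + 1)) (0 : Fin 2)).monotone.functor x ⋙
      Functor.uncurry.obj (ComposableArrows.mk₁ α) : ComposableArrows D k) = x ⋙ F :=
  -- On arrows, the uncurried functor puts a component of the image of an identity of `Fin 2` before
  -- `F.map`; that component is an identity.
  CategoryTheory.Functor.hext (fun _ => rfl) fun i _ f => heq_of_eq
    ((congrArg (fun β => β ≫ F.map (x.map f)) (NatTrans.congr_app
      ((ComposableArrows.mk₁ α).map_id 0) (x.obj i))).trans (Category.id_comp _))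

theorem nerveHomotopy_one {k : ℕ} (x : ComposableArrows C k) :
    (Functor.prod' (OrderHom.const (Fin (k + 1)) (1 : Fin 2)).monotone.functor x ⋙
      Functor.uncurry.obj (ComposableArrows.mk₁ α) : ComposableArrows D k) = x ⋙ G :=
  CategoryTheory.Functor.hext (fun _ => rfl) fun i _ f => heq_of_eq
    ((congrArg (fun β => β ≫ G.map (x.map f)) (NatTrans.congr_app
      ((ComposableArrows.mk₁ α).map_id 1) (x.obj i))).trans (Category.id_comp _))

/-- The map `B C × Δ¹ → B D` given by a natural transformation. -/
def geomHomotopy (p : Geom (nerve C) × stdSimplex ℝ (Fin 2)) : Geom (nerve D) :=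
  Geom.map (nerveHomotopy α) (prodSet.pair p.1
    (Geom.mk (X := intervalSet.{max u v}) (k := .mk 1) ⟨OrderHom.id⟩ p.2))

theorem continuous_geomHomotopy : Continuous (geomHomotopy α) :=
  (Geom.continuous_map _).comp (prodSet.continuous_pair_mk (X := nerve C)
    (Y := intervalSet.{max u v}) (m := .mk 1) ⟨OrderHom.id⟩)

/-- A measure is coupled with a vertex by its own chain and a constant map. -/
theorem geomHomotopy_vertex (i : Fin 2) (k : SimplexCategory) (x : (nerve C).obj (op k))
    (σ : stdSimplex ℝ (Fin (k.len + 1))) :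
    geomHomotopy α (Geom.mk x σ, stdSimplex.vertex i) =
      Geom.mk (X := nerve D) (k := k)
        (Functor.prod' (OrderHom.const (Fin (k.len + 1)) i).monotone.functor x ⋙
          Functor.uncurry.obj (ComposableArrows.mk₁ α) : ComposableArrows D k.len) σ := by
  have h := prodSet.pair_mk_eq (X := nerve C) (Y := intervalSet.{max u v}) (m := .mk 1) x
    ⟨OrderHom.id⟩ (k := k.len) OrderHom.id (OrderHom.const _ i) σ
  have h1 : stdSimplex.map (OrderHom.id : Fin (k.len + 1) →o _) σ = σ := stdSimplex.map_id_apply σ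
  have h2 : stdSimplex.map (OrderHom.const (Fin (k.len + 1)) i) σ = stdSimplex.vertex i :=
    stdSimplex_map_const i σ
  rw [h1] at h
  have h3 := congrArg (Geom.map (nerveHomotopy α)) h
  rw [← h2]
  exact h3

/-- A natural transformation induces a homotopy between the maps of classifying spaces. -/
theorem homotopic_of_natTrans (α : F ⟶ G) :
    (geomMap F).Homotopic (geomMap G) := by
  refine ⟨⟨⟨fun p => geomHomotopy α (p.2, stdSimplexHomeomorphUnitInterval.symm p.1),
    (continuous_geomHomotopy α).comp (continuous_snd.prodMk
      (stdSimplexHomeomorphUnitInterval.symm.continuous.comp continuous_fst))⟩, ?_, ?_⟩⟩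
  · intro z
    obtain ⟨k, x, σ, rfl⟩ := Geom.exists_mk z
    have h : stdSimplexHomeomorphUnitInterval.symm 0 = stdSimplex.vertex 0 := by
      rw [Homeomorph.symm_apply_eq]
      exact stdSimplexHomeomorphUnitInterval_zero.symm
    refine (congrArg (fun t => geomHomotopy α (Geom.mk x σ, t)) h).trans ?_
    rw [geomHomotopy_vertex]
    exact congrArg (fun y => Geom.mk (X := nerve D) (k := k) y σ) (nerveHomotopy_zero α x)
  · intro z
    obtain ⟨k, x, σ, rfl⟩ := Geom.exists_mk z
    have h : stdSimplexHomeomorphUnitInterval.symm 1 = stdSimplex.vertex 1 := by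
      rw [Homeomorph.symm_apply_eq]
      exact stdSimplexHomeomorphUnitInterval_one.symm
    refine (congrArg (fun t => geomHomotopy α (Geom.mk x σ, t)) h).trans ?_
    rw [geomHomotopy_vertex]
    exact congrArg (fun y => Geom.mk (X := nerve D) (k := k) y σ) (nerveHomotopy_one α x)

end Homotopy

/-! ### Classifying spaces form partially realized multisimplicial sets -/

/-- The functor which separates the last coordinate from the others. -/
def separate (n : ℕ) : DeltaPow (n + 1) ⥤ DeltaPow n × SimplexCategoryᵒᵖ :=
  Functor.prod' (Functor.pi' fun j : Fin n => Pi.eval _ j.castSucc) (Pi.eval _ (Fin.last n))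

theorem append_separate (n : ℕ) : append n ⋙ separate n = 𝟭 _ := by
  have h1 : append n ⋙ Pi.eval _ (Fin.last n) = CategoryTheory.Prod.snd _ _ :=
    Fin.lastCases_last
      (motive := fun _ => DeltaPow n × SimplexCategoryᵒᵖ ⥤ SimplexCategoryᵒᵖ)
  have h2 : append n ⋙ (Functor.pi' fun j : Fin n => Pi.eval _ j.castSucc) =
      CategoryTheory.Prod.fst _ _ := by
    refine Functor.pi_ext _ _ fun j => ?_
    exact Fin.lastCases_castSucc
      (motive := fun _ => DeltaPow n × SimplexCategoryᵒᵖ ⥤ SimplexCategoryᵒᵖ) j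
  change Functor.prod' (append n ⋙ (Functor.pi' fun j : Fin n => Pi.eval _ j.castSucc))
    (append n ⋙ Pi.eval _ (Fin.last n)) = _
  rw [h1, h2]
  rfl

theorem isPRmss_classifyingSpace {n : ℕ} (V : DeltaPow n ⥤ Cat.{v, u}) :
    IsPRmss (V ⋙ classifyingSpace.{v, u}) := by
  -- One realized coordinate suffices: the multisimplicial set sends `(a, k)` to the `k`-simplices
  -- of the nerve of `V a`.
  refine ⟨1, separate n ⋙ Functor.uncurry.obj (V ⋙ nerveSpace), fun a => ⟨rfl⟩, ⟨eqToIso ?_⟩⟩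
  change (V ⋙ nerveSpace) ⋙ realization =
    Functor.curry.obj ((append n ⋙ separate n) ⋙ Functor.uncurry.obj (V ⋙ nerveSpace)) ⋙ realization
  rw [append_separate, Functor.id_comp, Functor.curry_obj_uncurry_obj]

/-! ### Homotopy equivalences of classifying spaces -/

section Categories

variable {A B C D : Type u} [Category.{v} A] [Category.{v} B] [Category.{v} C] [Category.{v} D]

theorem geomMap_comp (F : A ⥤ B) (G : B ⥤ C) :
    (geomMap G).comp (geomMap F) = geomMap (F ⋙ G) :=
  ContinuousMap.ext fun z => (Geom.map_comp_apply (nerveMap F) (nerveMap G) z).symm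

theorem geomMap_id : geomMap (𝟭 A) = ContinuousMap.id _ :=
  ContinuousMap.ext fun z => Geom.map_id_apply z

/-- If `J`, `J'` are left adjoint to `E`, `E'` and `J ⋙ P ⋙ E'` is an isomorphism of categories, then
`P` induces a homotopy equivalence of classifying spaces. -/
theorem exists_homotopyEquiv_geomMap {J : C ⥤ A} {E : A ⥤ C} (ε : E ⋙ J ⟶ 𝟭 A)
    {J' : D ⥤ B} {E' : B ⥤ D} (ε' : E' ⋙ J' ⟶ 𝟭 B) (P : A ⥤ B) {w : C ⥤ D} {w' : D ⥤ C}
    (hw : w = J ⋙ P ⋙ E') (h : w ⋙ w' = 𝟭 C) (h' : w' ⋙ w = 𝟭 D) :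
    ∃ e : ContinuousMap.HomotopyEquiv (Geom (nerve A)) (Geom (nerve B)), e.toFun = geomMap P := by
  subst hw
  refine ⟨⟨geomMap P, geomMap (E' ⋙ w' ⋙ J), ?_, ?_⟩, rfl⟩
  · rw [geomMap_comp, ← geomMap_id]
    -- Inserting `w ⋙ w' = 𝟭 C` between `E` and `J` exposes a second factor `E ⋙ J`, which `ε`
    -- contracts. Thus `E ⋙ J` maps both to the composite and to the identity.
    have α : E ⋙ J ⟶ P ⋙ E' ⋙ w' ⋙ J :=
      eqToHom (congrArg (fun F => E ⋙ F ⋙ J) h.symm) ≫ Functor.whiskerRight ε (P ⋙ E' ⋙ w' ⋙ J)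
    exact (homotopic_of_natTrans α).symm.trans (homotopic_of_natTrans ε)
  · rw [geomMap_comp, ← geomMap_id]
    have α : E' ⋙ J' ⟶ (E' ⋙ w' ⋙ J) ⋙ P :=
      eqToHom (congrArg (fun F => E' ⋙ F ⋙ J') h'.symm) ≫
        Functor.whiskerLeft ((E' ⋙ w' ⋙ J) ⋙ P) ε'
    exact (homotopic_of_natTrans α).symm.trans (homotopic_of_natTrans ε')

/-- The counit of the adjunction between the powers of two adjoint functors. -/
def piCounit {J : C ⥤ A} {E : A ⥤ C} (ε : E ⋙ J ⟶ 𝟭 A) (m : ℕ) :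
    (Functor.pi fun _ : Fin m => E) ⋙ (Functor.pi fun _ : Fin m => J) ⟶ 𝟭 (Fin m → A) where
  app x j := ε.app (x j)
  naturality _ _ f := funext fun j => ε.naturality (f j)

/-- The nerve commutes with finite powers. -/
def nervePow (A : Type u) [Category.{v} A] (m : ℕ) : nerve (Fin m → A) ≅ powSet (nerve A) m where
  hom := { app := fun _ => ↾fun x j => x ⋙ Pi.eval (fun _ : Fin m => A) j }
  inv := { app := fun _ => ↾fun x => Functor.pi' x }

/-- The realization of the nerve of a power of a category. -/
def nervePowHomeomorph (A : Type u) [Category.{v} A] (m : ℕ) :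
    Geom (nerve (Fin m → A)) ≃ₜ Geom (powSet (nerve A) m) where
  toFun := Geom.map (nervePow A m).hom
  invFun := Geom.map (nervePow A m).inv
  left_inv z := by rw [← Geom.map_comp_apply, Iso.hom_inv_id, Geom.map_id_apply]
  right_inv z := by rw [← Geom.map_comp_apply, Iso.inv_hom_id, Geom.map_id_apply]
  continuous_toFun := Geom.continuous_map _
  continuous_invFun := Geom.continuous_map _

/-- The classifying space of a power of a category is the power of the classifying space. -/
def classifyingPow (A : Type u) [Category.{v} A] (m : ℕ) :
    Geom (nerve (Fin m → A)) ≃ₜ CGPow (Geom (nerve A)) m :=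
  (nervePowHomeomorph A m).trans (powSet.homeomorph _ m)

theorem classifyingPow_geomMap {m : ℕ} (F : Fin m → (A ⥤ B)) (z : Geom (nerve A)) (j : Fin m) :
    classifyingPow B m (geomMap (Functor.pi' F) z) j = geomMap (F j) z := by
  change Geom.map _ (Geom.map _ (Geom.map _ z)) = Geom.map _ z
  rw [← Geom.map_comp_apply, ← Geom.map_comp_apply]
  rfl

end Categories

/-- The Segal maps of the classifying spaces of a rectification of a Segal lax functor are homotopy
equivalences. -/
theorem exists_homotopyEquiv_segal {n : ℕ} {W : LaxToCat.{v, u} (DeltaPow n)} (hW : IsSegalLax W)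
    {V : DeltaPow n ⥤ Cat.{v, u}} (hV : IsRectification V W) (l : Fin n) (k m : ℕ) :
    ∃ e : ContinuousMap.HomotopyEquiv
        ((line l k ⋙ V ⋙ classifyingSpace.{v, u}).obj (op (SimplexCategory.mk m)))
        (CGPow ((line l k ⋙ V ⋙ classifyingSpace.{v, u}).obj (op (SimplexCategory.mk 1))) m),
      ∀ x (j : Fin m), e.toFun x j = (line l k ⋙ V ⋙ classifyingSpace.{v, u}).map (proj j) x := by
  obtain ⟨E, J, hadj, hmap⟩ := hV
  let a : LocallyDiscrete (DeltaPow n) := ⟨(line l k).obj (op (SimplexCategory.mk m))⟩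
  let b : LocallyDiscrete (DeltaPow n) := ⟨(line l k).obj (op (SimplexCategory.mk 1))⟩
  let P : V.obj a.as ⥤ (Fin m → V.obj b.as) :=
    Functor.pi' fun j : Fin m => (V.map ((line l k).map (proj j))).toFunctor
  -- The equality `W = E V J`, taken at the arrows `proj j`, holds in each coordinate of the power.
  have hseg : (segalFunctor (restrict (line l k) W) m).toFunctor =
      (J.app a).toFunctor ⋙ P ⋙ Functor.pi fun _ : Fin m => (E.app b).toFunctor := by
    refine Functor.pi_ext _ _ fun j => ?_
    exact congrArg Cat.Hom.toFunctor (hmap ((line l k).map (proj j)).toLoc)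
  have := hW l k m
  let s := segalFunctor (restrict (line l k) W) m
  obtain ⟨e, he⟩ := exists_homotopyEquiv_geomMap (hadj a).some.counit
    (piCounit (hadj b).some.counit m) P hseg
    (congrArg Cat.Hom.toFunctor (IsIso.hom_inv_id s))
    (congrArg Cat.Hom.toFunctor (IsIso.inv_hom_id s))
  refine ⟨e.trans (classifyingPow (V.obj b.as) m).toHomotopyEquiv, fun x j => ?_⟩
  change classifyingPow (V.obj b.as) m (e.toFun x) j = _
  rw [he]
  exact classifyingPow_geomMap _ x j

end SegalMultisimplicial

end

theorem corollary4p4 (n : ℕ) (hn : 1 ≤ n)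
    (W : SegalMultisimplicial.LaxToCat.{v, u} (SegalMultisimplicial.DeltaPow n))
    (hW : SegalMultisimplicial.IsSegalLax W)
    (V : SegalMultisimplicial.DeltaPow n ⥤ Cat.{v, u})
    (hV : SegalMultisimplicial.IsRectification V W) :
    SegalMultisimplicial.IsSegalMultisimplicialSpace
      (V ⋙ SegalMultisimplicial.classifyingSpace.{v, u}) :=
  ⟨SegalMultisimplicial.isPRmss_classifyingSpace V, fun l k =>
    -- A slice of `B ∘ V` is again the classifying space of a functor to `Cat`, so the same lemma
    -- applies to it.
    ⟨SegalMultisimplicial.isPRmss_classifyingSpace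
      (Pi.eval (fun _ : Fin 1 => SimplexCategoryᵒᵖ) 0 ⋙ SegalMultisimplicial.line l k ⋙ V),
      SegalMultisimplicial.exists_homotopyEquiv_segal hW hV l k⟩⟩
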